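/- Conventions. All groups are discrete and countable. Let $\Lambda,\Gamma$ be groups. An SMI-coupling (or $(\Lambda\rightarrowtail\Gamma)$-coupling) is a standard Borel space $\Sigma$ with a measure $\mu$ and a measurable, measure preserving action of $\Lambda\times\Gamma$, such that the actions $\Lambda\curvearrowright\Sigma$ and $\Gamma\curvearrowright\Sigma$ admit Borel fundamental domains $Y$ and $X$ respectively (so that, up to null sets, $\Sigma=\bigsqcup_{\lambda\in\Lambda}\lambda Y=\bigsqcup_{\gamma\in\Gamma}\gamma X$) with $X\subset Y$ and $0<\mu(X)<\infty$. Its index is $\mu(Y)/\mu(X)\in[1,\infty]$. If such a coupling exists, $\Lambda$ is said to strictly measurably imbed into $\Gamma$, written $\Lambda\overset{\mathrm{SMI}}{\rightarrowtail}\Gamma$. The graph product of groups $\{A_v\}_{v\in V}$ over a simple graph $\Theta$ with vertex set $V$ is the quotient of the free product of the $A_v$ by the relations $[a,b]=e$ for $a\in A_u$, $b\in A_v$ with $u,v$ adjacent. The graph $\Theta$ is irreducible if it is not the join of two nonempty full subgraphs, i.e. if $V$ is not the union of two nonempty sets $S,T$ such that every vertex of $S$ is adjacent to every vertex of $T$.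 Theorem. Let $\Theta$ be a finite simple irreducible graph with vertex set $V$ and at least two vertices. Let $H$ and $G$ be the graph products over $\Theta$ of nontrivial finitely generated groups $\{H_v\}_{v\in V}$ and $\{G_v\}_{v\in V}$, respectively. Suppose that there is a vertex $w\in V$ such that $H_w\overset{\mathrm{SMI}}{\rightarrowtail}G_w$ with an SMI-coupling of index $c\in[1,\infty]$, and that $H_v\cong G_v$ for all $v\in V$ with $v\neq w$. Then $H\overset{\mathrm{SMI}}{\rightarrowtail}G$ with an SMI-coupling (on a space of infinite measure) whose index is $1$ if $c=1$, and $\infty$ if $c\neq 1$. -/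

import Mathlib

open MeasureTheory
open scoped ENNReal

/-- The subset of the free product of the groups `A v` that consists of the commutators
`a b a⁻¹ b⁻¹` with `a ∈ A u`, `b ∈ A v` and `u, v` adjacent in `Θ`. -/
def graphProductRelators {V : Type*} (Θ : SimpleGraph V) (A : V → Type*)
    [∀ v, Group (A v)] : Set (Monoid.CoprodI A) :=
  {r | ∃ u v : V, Θ.Adj u v ∧ ∃ (a : A u) (b : A v),
    r = Monoid.CoprodI.of a * Monoid.CoprodI.of b *
      (Monoid.CoprodI.of a)⁻¹ * (Monoid.CoprodI.of b)⁻¹}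

/-- The graph product over `Θ` of the groups `A v`: the free product of the `A v`, modulo the
relations that `A u` and `A v` commute whenever `u` and `v` are adjacent in `Θ`. -/
abbrev GraphProduct {V : Type*} (Θ : SimpleGraph V) (A : V → Type*)
    [∀ v, Group (A v)] : Type _ :=
  Monoid.CoprodI A ⧸ Subgroup.normalClosure (graphProductRelators Θ A)

/-- `Θ` is the join of its full (induced) subgraphs on `S` and `T`: its vertex set is `S ∪ T`,
and every vertex of `S` is joined by an edge to every vertex of `T`.
(Edges inside `S` and inside `T` are those of `Θ`, and `S`, `T` are automatically disjoint,
because `Θ` has no loops.) -/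
def SimpleGraph.IsJoinOf {V : Type*} (Θ : SimpleGraph V) (S T : Set V) : Prop :=
  S ∪ T = Set.univ ∧ ∀ s ∈ S, ∀ t ∈ T, Θ.Adj s t

/-- A graph is irreducible if it is not the join of two nonempty full subgraphs. -/
def SimpleGraph.IsIrreducible {V : Type*} (Θ : SimpleGraph V) : Prop :=
  ¬ ∃ S T : Set V, S.Nonempty ∧ T.Nonempty ∧ Θ.IsJoinOf S T

/-- A `(Λ ↣ Γ)`-coupling in the sense of strict measurable imbeddings (for countable groups):
a standard Borel space `Ω` with a measure `μ` and a measurable, measure preserving action of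
`Λ × Γ` (that is, commuting actions of `Λ` and `Γ`), together with Borel fundamental domains
`Y` for `Λ` and `X` for `Γ` such that `X ⊆ Y` and `0 < μ X < ∞`.

`IsFundamentalDomain` is the notion up to null sets: the translates of the set are pairwise
disjoint up to null sets and cover almost every point. Since `X` has finite measure and
countably many translates of it cover almost every point, `μ` is automatically sigma-finite.
Every standard Borel space is isomorphic to one in `Type`. -/
structure SMICoupling (Λ Γ : Type*) [Group Λ] [Group Γ] where
  Ω : Type
  [measurableSpace : MeasurableSpace Ω]
  [standardBorel : StandardBorelSpace Ω]
  μ : Measure Ω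
  [actionLeft : MulAction Λ Ω]
  [actionRight : MulAction Γ Ω]
  [commute : SMulCommClass Λ Γ Ω]
  measurePreserving_left : ∀ l : Λ, MeasurePreserving (fun x : Ω => l • x) μ μ
  measurePreserving_right : ∀ g : Γ, MeasurePreserving (fun x : Ω => g • x) μ μ
  X : Set Ω
  Y : Set Ω
  measurableSet_X : MeasurableSet X
  measurableSet_Y : MeasurableSet Y
  isFundamentalDomain_X : IsFundamentalDomain Γ X μ
  isFundamentalDomain_Y : IsFundamentalDomain Λ Y μ
  subset : X ⊆ Y
  measure_X_ne_zero : μ X ≠ 0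
  measure_X_ne_top : μ X ≠ ∞

attribute [instance] SMICoupling.measurableSpace SMICoupling.standardBorel

/-- The index `[Γ : Λ]` of a coupling: the ratio `μ(Y) / μ(X)`, an element of `[1, ∞]`. -/
noncomputable def SMICoupling.index {Λ Γ : Type*} [Group Λ] [Group Γ]
    (S : SMICoupling Λ Γ) : ℝ≥0∞ :=
  S.μ S.Y / S.μ S.X

/-! After discarding a null set, `X` and `Y` meet every orbit exactly once. On `X × G` let `a ∈ H w`
act by `(x, m) ↦ (b a x, m b⁻¹)`, where `b ∈ G w` returns `a x` to `X`, and let the other `H v ≅ G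
v` act by right translations. Adjacent vertex groups commute, so the graph product acts
(`inducedAction`); it preserves the measure and commutes with left translation by `G`, for which `X
× {1}` is a fundamental domain.

Freeness comes from exchanging the roles: `G` acts on `Y × H` through returns to `Y`, and `(x, m) ↦
m • (x, 1)` turns the action of `H` into left translation of the factor `H`
(`eq_one_of_inducedAction_eq`). Minimising an enumeration of `G` along `H`-orbits then gives a
fundamental domain containing `X × {1}` (`exists_coupling_of_skew`).

If `Y = X`, every `H`-orbit meets `X × {1}` and the index is `1`. If `Y \ X` is not null, an
`H`-invariant map, built from an action of `G` on `Y` times a coset space, separates infinitely many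
sets `D × {γ n}` of equal positive measure (`exists_separated_translates`), so the index is
infinite. Irreducibility supplies a vertex `v ≠ w` not adjacent to `w`, from which the `γ n` are
made. -/

theorem Group.FG.countable (G : Type*) [Group G] [h : Group.FG G] : Countable G := by
  obtain ⟨S, hS, f, hf⟩ := Group.fg_iff_exists_freeGroup_hom_surjective.1 h
  have := hS.countable.to_subtype
  have : Countable (FreeGroup S) := Quot.mk_surjective.countable
  exact hf.countable

instance Monoid.CoprodI.instCountable {V : Type*} [Countable V] (A : V → Type*)
    [∀ v, Monoid (A v)] [∀ v, Countable (A v)] : Countable (Monoid.CoprodI A) :=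
  have : Countable (FreeMonoid (Σ v, A v)) := inferInstanceAs (Countable (List (Σ v, A v)))
  Function.Surjective.countable (Con.mk'_surjective (c := conGen (Monoid.CoprodI.Rel A)))

/-! ### Universal property of graph products -/

namespace GraphProduct

variable {V : Type*} {Θ : SimpleGraph V} {A : V → Type*} [∀ v, Group (A v)]

/-- The inclusion of a vertex group. -/
def of (Θ : SimpleGraph V) (v : V) : A v →* GraphProduct Θ A :=
  (QuotientGroup.mk' _).comp Monoid.CoprodI.of

/-- The universal property of the graph product. -/
def lift {N : Type*} [Group N] (f : ∀ v, A v →* N)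
    (hf : ∀ u v, Θ.Adj u v → ∀ a b, Commute (f u a) (f v b)) : GraphProduct Θ A →* N :=
  QuotientGroup.lift _ (Monoid.CoprodI.lift f) (by
    refine Subgroup.normalClosure_le_normal ?_
    rintro _ ⟨u, v, huv, a, b, rfl⟩
    simp [(hf u v huv a b).eq])

@[simp]
theorem lift_of {N : Type*} [Group N] (f : ∀ v, A v →* N)
    (hf : ∀ u v, Θ.Adj u v → ∀ a b, Commute (f u a) (f v b)) (v : V) (a : A v) :
    lift f hf (of Θ v a) = f v a :=
  Monoid.CoprodI.lift_of f a

theorem commute_of {u v : V} (h : Θ.Adj u v) (a : A u) (b : A v) :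
    Commute (of Θ u a) (of Θ v b) := by
  have : ((Monoid.CoprodI.of a * Monoid.CoprodI.of b *
      (Monoid.CoprodI.of a)⁻¹ * (Monoid.CoprodI.of b)⁻¹ : Monoid.CoprodI A) :
      GraphProduct Θ A) = 1 :=
    (QuotientGroup.eq_one_iff _).2 (Subgroup.subset_normalClosure ⟨u, v, h, a, b, rfl⟩)
  exact commutatorElement_eq_one_iff_commute.1 this

@[elab_as_elim]
theorem induction_on {p : GraphProduct Θ A → Prop} (g : GraphProduct Θ A) (one : p 1)
    (of : ∀ v (a : A v), p (of Θ v a)) (mul : ∀ x y, p x → p y → p (x * y)) : p g := by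
  induction g using QuotientGroup.induction_on with
  | H z =>
    induction z using Monoid.CoprodI.induction_on with
    | one => exact one
    | of v a => exact of v a
    | mul x y hx hy => exact mul _ _ hx hy

end GraphProduct

/-! ### Normal forms and cosets in free products -/

namespace Monoid.CoprodI

variable {V : Type*} {A : V → Type*} [∀ v, Group (A v)]

/-- Elements of `A w` have reduced words that are empty or a single letter from `A w`, whereas the
last letter of `x` comes from `A v`. -/
theorem NeWord.prod_notMem_range_of {v w : V} (hvw : v ≠ w) (x : NeWord A w v) :
    x.prod ∉ (of : A w →* CoprodI A).range := by
  classical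
  rintro ⟨a, ha⟩
  have inj : ∀ y z : Word A, y.prod = z.prod → y = z := Word.equiv.symm.injective
  by_cases h1 : a = 1
  · rw [h1, map_one] at ha
    have := inj Word.empty x.toWord ha
    exact x.toList_ne_nil (congrArg Word.toList this).symm
  · have h2 := inj (NeWord.singleton a h1).toWord x.toWord
      ((NeWord.prod_singleton a h1).trans ha)
    have h3 := (NeWord.singleton a h1).toList_getLast?
    rw [show (NeWord.singleton a h1).toList = x.toList from congrArg Word.toList h2,
      x.toList_getLast?] at h3
    exact hvw (congrArg Sigma.fst (Option.some.inj h3))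

theorem pow_mul_notMem_range_of {v w : V} (hvw : v ≠ w) {s : A v} (hs : s ≠ 1) {t : A w}
    (ht : t ≠ 1) (n : ℕ) :
    ((of t * of s : CoprodI A) ^ (n + 1)) ∉ (of : A w →* CoprodI A).range := by
  suffices ∃ x : NeWord A w v, x.prod = (of t * of s) ^ (n + 1) by
    obtain ⟨x, hx⟩ := this
    exact hx ▸ x.prod_notMem_range_of hvw
  induction n with
  | zero =>
    exact ⟨(NeWord.singleton t ht).append hvw.symm (NeWord.singleton s hs), by
      simp [NeWord.append_prod, NeWord.prod_singleton]⟩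
  | succ n ih =>
    obtain ⟨x, hx⟩ := ih
    exact ⟨x.append hvw ((NeWord.singleton t ht).append hvw.symm (NeWord.singleton s hs)), by
      simp [NeWord.append_prod, NeWord.prod_singleton, hx, pow_succ _ (n + 1)]⟩

/-- The cosets `(s t)ⁿ s A_w` are pairwise distinct. -/
theorem injective_pow_mul_coset {v w : V} (hvw : v ≠ w) {s : A v} (hs : s ≠ 1) {t : A w}
    (ht : t ≠ 1) : Function.Injective fun n : ℕ =>
      (((of s * of t) ^ n * of s : CoprodI A) : CoprodI A ⧸ (of : A w →* CoprodI A).range) := by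
  have key : ∀ m n : ℕ, m < n →
      (((of s * of t) ^ m * of s : CoprodI A) : CoprodI A ⧸ (of : A w →* CoprodI A).range) ≠
        (((of s * of t) ^ n * of s : CoprodI A) : CoprodI A ⧸ (of : A w →* CoprodI A).range) := by
    intro m n hmn h
    obtain ⟨k, rfl⟩ := Nat.exists_eq_add_of_lt hmn
    -- Equal cosets would put `((s t)ᵐ s)⁻¹ (s t)ⁿ s = (t s)ⁿ⁻ᵐ` into `A w`.
    refine pow_mul_notMem_range_of hvw hs ht k ?_
    rw [QuotientGroup.eq] at h
    convert h using 1
    have : (of s : CoprodI A) * (of t * of s) ^ (k + 1) = (of s * of t) ^ (k + 1) * of s := by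
      generalize k + 1 = j
      induction j with
      | zero => simp
      | succ j ih => rw [pow_succ, ← mul_assoc, ih, pow_succ]; simp only [mul_assoc]
    rw [eq_inv_mul_iff_mul_eq, mul_assoc, this, ← mul_assoc, ← pow_add, add_assoc]
  intro m n h
  rcases lt_trichotomy m n with h' | h' | h'
  · exact (key m n h' h).elim
  · exact h'
  · exact (key n m h' h.symm).elim

end Monoid.CoprodI

/-! ### Return cocycles and skew actions -/

section Skew

variable {Ω A B M : Type*} [Group A] [Group B] [Group M] [MulAction A Ω] [MulAction B Ω]
  {F : Set Ω}

/-- The element that moves a point into the exact fundamental domain `F`. -/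
noncomputable def returnElt (hF : ∀ ω : Ω, ∃! b : B, b • ω ∈ F) (ω : Ω) : B := (hF ω).choose

theorem returnElt_smul_mem (hF : ∀ ω : Ω, ∃! b : B, b • ω ∈ F) (ω : Ω) :
    returnElt hF ω • ω ∈ F := (hF ω).choose_spec.1

theorem eq_returnElt (hF : ∀ ω : Ω, ∃! b : B, b • ω ∈ F) {ω : Ω} {b : B} (h : b • ω ∈ F) :
    b = returnElt hF ω := (hF ω).choose_spec.2 b h

/-- The return map of `a` to the exact fundamental domain `F`. -/
noncomputable def returnMap (hF : ∀ ω : Ω, ∃! b : B, b • ω ∈ F) (a : A) (x : F) : F :=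
  ⟨returnElt hF (a • (x : Ω)) • a • (x : Ω), returnElt_smul_mem hF _⟩

/-- If the actions of `A` and `B` commute and `F` is an exact fundamental domain for `B`, then `A`
acts on `F × M` through the return cocycle with values in `B`, followed by `ι : B → M`. -/
@[reducible]
noncomputable def skewAction [SMulCommClass A B Ω] (hF : ∀ ω : Ω, ∃! b : B, b • ω ∈ F)
    (ι : B →* M) : MulAction A (F × M) where
  smul a p := (returnMap hF a p.1, p.2 * (ι (returnElt hF (a • (p.1 : Ω))))⁻¹)
  one_smul p := by
    have h : (1 : B) = returnElt hF ((1 : A) • (p.1 : Ω)) :=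
      eq_returnElt hF (by simp)
    refine Prod.ext (Subtype.ext ?_) ?_
    · change returnElt hF ((1 : A) • (p.1 : Ω)) • (1 : A) • (p.1 : Ω) = p.1
      rw [← h, one_smul, one_smul]
    · change p.2 * (ι (returnElt hF ((1 : A) • (p.1 : Ω))))⁻¹ = p.2
      rw [← h]; simp
  mul_smul a a' p := by
    -- The cocycle identity: the product on the left also moves `(a a') x` into `F`, and such an
    -- element is unique.
    have h : returnElt hF (a • (returnMap hF a' p.1 : Ω)) * returnElt hF (a' • (p.1 : Ω)) =
        returnElt hF ((a * a') • (p.1 : Ω)) := by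
      refine eq_returnElt hF ?_
      have := returnElt_smul_mem hF (a • (returnMap hF a' p.1 : Ω))
      convert this using 1
      rw [mul_smul, mul_smul]
      congr 1
      exact (smul_comm _ _ _).symm
    refine Prod.ext (Subtype.ext ?_) ?_
    · change returnElt hF ((a * a') • (p.1 : Ω)) • (a * a') • (p.1 : Ω) =
        returnElt hF (a • (returnMap hF a' p.1 : Ω)) • a • (returnMap hF a' p.1 : Ω)
      rw [← h, mul_smul, mul_smul]
      congr 1
      exact (smul_comm _ _ _).symm
    · change p.2 * (ι (returnElt hF ((a * a') • (p.1 : Ω))))⁻¹ =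
        p.2 * (ι (returnElt hF (a' • (p.1 : Ω))))⁻¹ *
          (ι (returnElt hF (a • (returnMap hF a' p.1 : Ω))))⁻¹
      rw [← h, map_mul, mul_inv_rev, mul_assoc]

/-- `skewAction` as a homomorphism. -/
noncomputable def skewHom [SMulCommClass A B Ω] (hF : ∀ ω : Ω, ∃! b : B, b • ω ∈ F)
    (ι : B →* M) : A →* Equiv.Perm (F × M) :=
  letI := skewAction (A := A) hF ι
  MulAction.toPermHom A (F × M)

theorem skewHom_apply [SMulCommClass A B Ω] (hF : ∀ ω : Ω, ∃! b : B, b • ω ∈ F)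
    (ι : B →* M) (a : A) (x : F) (m : M) :
    skewHom hF ι a (x, m) = (returnMap hF a x, m * (ι (returnElt hF (a • (x : Ω))))⁻¹) := rfl

theorem skewHom_eq [SMulCommClass A B Ω] (hF : ∀ ω : Ω, ∃! b : B, b • ω ∈ F)
    (ι : B →* M) {a : A} {b : B} {x y : F} (h : b • a • (x : Ω) = y) (m : M) :
    skewHom hF ι a (x, m) = (y, m * (ι b)⁻¹) := by
  have hb : b = returnElt hF (a • (x : Ω)) := eq_returnElt hF (h ▸ y.2)
  rw [skewHom_apply, ← hb]
  exact Prod.ext (Subtype.ext (by simp only [returnMap]; rw [← hb, h])) rfl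

/-- The action of `A` on `X × M` by right translations along `j : A → M`. -/
def rightHom (X : Type*) (j : A →* M) : A →* Equiv.Perm (X × M) where
  toFun a :=
    { toFun := fun p => (p.1, p.2 * (j a)⁻¹)
      invFun := fun p => (p.1, p.2 * j a)
      left_inv := fun p => by simp
      right_inv := fun p => by simp }
  map_one' := by ext <;> simp
  map_mul' a b := by ext <;> simp [mul_assoc]

theorem rightHom_apply (X : Type*) (j : A →* M) (a : A) (p : X × M) :
    rightHom X j a p = (p.1, p.2 * (j a)⁻¹) := rfl

end Skew

/-! ### Skew actions of graph products -/

namespace GraphProduct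

variable {V : Type*} {Θ : SimpleGraph V} {A B : V → Type*} [∀ v, Group (A v)] [∀ v, Group (B v)]

section

variable {w : V} {Ω M : Type*} [Group M] [MulAction (A w) Ω] [MulAction (B w) Ω]
  [SMulCommClass (A w) (B w) Ω] {F : Set Ω}

open Classical in
/-- The action on `F × M` of the graph product of the `A v` in which `A w` acts by `skewHom` and
the other `A v` act by right translations. -/
noncomputable def skew (hF : ∀ ω : Ω, ∃! b : B w, b • ω ∈ F) (φ : ∀ v, A v →* B v)
    (k : ∀ v, B v →* M) (hk : ∀ u v, Θ.Adj u v → ∀ a b, Commute (k u a) (k v b)) :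
    GraphProduct Θ A →* Equiv.Perm (F × M) :=
  lift (Function.update (fun v => rightHom F ((k v).comp (φ v))) w (skewHom hF (k w))) (by
    -- `A w` multiplies the second coordinate by elements of `k w`, and these commute with the image
    -- of `k v`; the first coordinate is moved by `A w` alone.
    have h1 : ∀ v, Θ.Adj w v → ∀ a b, Commute (skewHom (A := A w) hF (k w) a)
        (rightHom F ((k v).comp (φ v)) b) := by
      intro v hv a b
      refine Equiv.ext fun p => ?_
      obtain ⟨x, m⟩ := p
      simp only [Equiv.Perm.mul_apply, skewHom_apply, rightHom_apply]
      refine Prod.ext rfl ?_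
      have := (hk w v hv (returnElt hF (a • (x : Ω))) (φ v b)).inv_inv.eq
      simp [mul_assoc, this]
    intro u v huv a b
    by_cases hu : u = w
    · subst hu
      have hv : v ≠ u := huv.ne'
      simp only [Function.update_self, Function.update_of_ne hv]
      exact h1 v huv a b
    · by_cases hv : v = w
      · subst hv
        simp only [Function.update_self, Function.update_of_ne hu]
        exact (h1 u huv.symm b a).symm
      · simp only [Function.update_of_ne hu, Function.update_of_ne hv]
        refine Equiv.ext fun p => ?_
        simp only [Equiv.Perm.mul_apply, rightHom_apply]
        refine Prod.ext rfl ?_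
        have := (hk u v huv (φ u a) (φ v b)).inv_inv.eq
        simp [mul_assoc, this])

variable (hF : ∀ ω : Ω, ∃! b : B w, b • ω ∈ F) (φ : ∀ v, A v →* B v)
    (k : ∀ v, B v →* M) (hk : ∀ u v, Θ.Adj u v → ∀ a b, Commute (k u a) (k v b))

theorem skew_of_self (a : A w) : skew hF φ k hk (of Θ w a) = skewHom hF (k w) a := by
  classical
  rw [skew, lift_of, Function.update_self]

theorem skew_of_ne {v : V} (hv : v ≠ w) (a : A v) :
    skew hF φ k hk (of Θ v a) = rightHom F ((k v).comp (φ v)) a := by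
  classical
  rw [skew, lift_of, Function.update_of_ne hv]

/-- The action `skew` commutes with left translations. -/
theorem skew_mul_left (h : GraphProduct Θ A) (x : F) (n m : M) :
    skew hF φ k hk h (x, n * m) =
      ((skew hF φ k hk h (x, m)).1, n * (skew hF φ k hk h (x, m)).2) := by
  induction h using induction_on generalizing x m with
  | one => simp
  | of v a =>
    by_cases hv : v = w
    · subst hv
      simp only [skew_of_self, skewHom_apply, mul_assoc]
    · simp only [skew_of_ne hF φ k hk hv, rightHom_apply, mul_assoc]
  | mul a b ha hb => simp only [map_mul, Equiv.Perm.mul_apply, ha, hb]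

end

/-- An orbit map from `X × M` that is equivariant on the vertex groups is equivariant. -/
theorem orbitMap_equivariant {X M Z : Type*} [Group M]
    (σ : GraphProduct Θ A →* Equiv.Perm (X × M))
    (hσ : ∀ h x n m, σ h (x, n * m) = ((σ h (x, m)).1, n * (σ h (x, m)).2))
    (τ : M →* Equiv.Perm Z) (ρ : GraphProduct Θ A →* Equiv.Perm Z)
    (hcomm : ∀ m h z, τ m (ρ h z) = ρ h (τ m z)) (j : X → Z)
    (hj : ∀ v a x, τ (σ (of Θ v a) (x, 1)).2 (j (σ (of Θ v a) (x, 1)).1) = ρ (of Θ v a) (j x))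
    (h : GraphProduct Θ A) (p : X × M) :
    τ (σ h p).2 (j (σ h p).1) = ρ h (τ p.2 (j p.1)) := by
  induction h using induction_on generalizing p with
  | one => simp
  | of v a =>
    obtain ⟨x, m⟩ := p
    have := hσ (of Θ v a) x m 1
    rw [mul_one] at this
    rw [this, map_mul, Equiv.Perm.mul_apply, hj, hcomm]
  | mul a b ha hb => simp only [map_mul, Equiv.Perm.mul_apply, ha, hb]

end GraphProduct

/-! ### Passing to exact fundamental domains -/

section Restrict

open scoped Pointwise

theorem MeasureTheory.MeasurePreserving.subtype_of_iff {α : Type*} [MeasurableSpace α]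
    {μ : Measure α} {f : α → α} (hf : MeasurePreserving f μ μ) {s : Set α} (hs : MeasurableSet s)
    (h : ∀ x, f x ∈ s ↔ x ∈ s) :
    MeasurePreserving (fun x : s => (⟨f x, (h x).2 x.2⟩ : s))
      (μ.comap Subtype.val) (μ.comap Subtype.val) := by
  have hm : Measurable (fun x : s => (⟨f x, (h x).2 x.2⟩ : s)) :=
    (hf.measurable.comp measurable_subtype_coe).subtype_mk
  refine ⟨hm, Measure.ext fun E hE => ?_⟩
  rw [Measure.map_apply hm hE, comap_subtype_coe_apply hs, comap_subtype_coe_apply hs,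
    ← hf.measure_preimage (hs.subtype_image hE).nullMeasurableSet]
  congr 1
  ext x
  simp only [Set.mem_image, Set.mem_preimage, Subtype.exists, exists_and_right, exists_eq_right]
  exact ⟨fun ⟨h1, h2⟩ => ⟨(h x).2 h1, h2⟩, fun ⟨h1, h2⟩ => ⟨(h x).1 h1, h2⟩⟩

theorem MeasureTheory.measure_comap_val_preimage {α : Type*} [MeasurableSpace α]
    {μ : Measure α} {s : Set α} (hs : MeasurableSet s) (t : Set α) :
    μ.comap (Subtype.val : s → α) (Subtype.val ⁻¹' t) = μ (t ∩ s) := by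
  rw [comap_subtype_coe_apply hs, Subtype.image_preimage_coe, Set.inter_comm]

theorem MeasureTheory.IsFundamentalDomain.ae_existsUnique {G α : Type*} [Group G] [Countable G]
    [MulAction G α] [MeasurableSpace α] {s : Set α} {μ : Measure α}
    (h : IsFundamentalDomain G s μ) : ∀ᵐ x ∂μ, ∃! g : G, g • x ∈ s := by
  have h1 : ∀ᵐ x ∂μ, ∀ a b : G, a ≠ b → x ∉ a • s ∩ b • s := by
    rw [ae_all_iff]; intro a
    rw [ae_all_iff]; intro b
    by_cases hab : a = b
    · simp [hab]
    · have := measure_eq_zero_iff_ae_notMem.1 (h.aedisjoint hab)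
      filter_upwards [this] with x hx _ using hx
  filter_upwards [h.ae_covers, h1] with x ⟨g, hg⟩ hx
  refine ⟨g, hg, fun k hk => ?_⟩
  by_contra hne
  refine hx k⁻¹ g⁻¹ (fun h' => hne (inv_injective h')) ⟨?_, ?_⟩
  · rwa [Set.mem_smul_set_iff_inv_smul_mem, inv_inv]
  · rwa [Set.mem_smul_set_iff_inv_smul_mem, inv_inv]

theorem measurableSet_existsUnique_smul_mem {G α : Type*} [Group G] [Countable G]
    [MulAction G α] [MeasurableSpace α] {s : Set α} (hs : MeasurableSet s)
    (h : ∀ g : G, Measurable fun x : α => g • x) :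
    MeasurableSet {x : α | ∃! g : G, g • x ∈ s} := by
  simp only [ExistsUnique, Set.ofPred_exists, Set.ofPred_and, Set.ofPred_forall]
  refine MeasurableSet.iUnion fun g => (h g hs).inter (MeasurableSet.iInter fun k => ?_)
  exact (h k hs).himp (MeasurableSet.const _)

end Restrict

namespace SMICoupling

open scoped Pointwise

attribute [local instance] SMICoupling.actionLeft SMICoupling.actionRight SMICoupling.commute

variable {Λ Γ : Type*} [Group Λ] [Group Γ]

/-- The fundamental domains meet every orbit exactly once. -/
def IsExact (S : SMICoupling Λ Γ) : Prop :=
  (∀ ω : S.Ω, ∃! g : Γ, g • ω ∈ S.X) ∧ ∀ ω : S.Ω, ∃! l : Λ, l • ω ∈ S.Y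

/-- The points whose whole orbit under both groups has unique returns to `X` and to `Y` form an
invariant measurable set, which is conull because the groups are countable. Restricting to it
changes no measure. -/
theorem exists_isExact [Countable Λ] [Countable Γ] (S : SMICoupling Λ Γ) :
    ∃ T : SMICoupling Λ Γ, T.IsExact ∧ T.index = S.index ∧ (S.Y = S.X → T.Y = T.X) := by
  let D : Set S.Ω := {ω | ∀ (l : Λ) (g : Γ), (∃! k : Γ, k • l • g • ω ∈ S.X) ∧
    ∃! k : Λ, k • l • g • ω ∈ S.Y}
  have hml : ∀ l : Λ, Measurable fun x : S.Ω => l • x := fun l =>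
    (S.measurePreserving_left l).measurable
  have hmr : ∀ g : Γ, Measurable fun x : S.Ω => g • x := fun g =>
    (S.measurePreserving_right g).measurable
  have hD : MeasurableSet D := by
    simp only [D, Set.ofPred_forall]
    refine MeasurableSet.iInter fun l => MeasurableSet.iInter fun g => ?_
    exact ((hml l).comp (hmr g)) ((measurableSet_existsUnique_smul_mem S.measurableSet_X hmr).inter
      (measurableSet_existsUnique_smul_mem S.measurableSet_Y hml))
  have hD0 : S.μ Dᶜ = 0 := by
    have : ∀ᵐ ω ∂S.μ, ω ∈ D := by
      simp only [D, Set.mem_ofPred_eq]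
      rw [ae_all_iff]; intro l
      rw [ae_all_iff]; intro g
      have h := S.isFundamentalDomain_X.ae_existsUnique.and S.isFundamentalDomain_Y.ae_existsUnique
      exact ((S.measurePreserving_left l).comp
        (S.measurePreserving_right g)).quasiMeasurePreserving.ae h
    exact this
  have hl1 : ∀ (l : Λ) (ω : S.Ω), ω ∈ D → l • ω ∈ D := by
    intro l ω h l' g
    have := h (l' * l) g
    rwa [mul_smul, smul_comm l g ω] at this
  have hr1 : ∀ (g : Γ) (ω : S.Ω), ω ∈ D → g • ω ∈ D := by
    intro g ω h l g'
    have := h l (g' * g)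
    rwa [mul_smul] at this
  have hl : ∀ (l : Λ) (ω : S.Ω), l • ω ∈ D ↔ ω ∈ D := fun l ω =>
    ⟨fun h => by simpa using hl1 l⁻¹ _ h, hl1 l ω⟩
  have hr : ∀ (g : Γ) (ω : S.Ω), g • ω ∈ D ↔ ω ∈ D := fun g ω =>
    ⟨fun h => by simpa using hr1 g⁻¹ _ h, hr1 g ω⟩
  let actL : MulAction Λ D :=
    { smul := fun l ω => ⟨l • (ω : S.Ω), hl1 l _ ω.2⟩
      one_smul := fun ω => Subtype.ext (one_smul Λ (ω : S.Ω))
      mul_smul := fun a b ω => Subtype.ext (mul_smul a b (ω : S.Ω)) }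
  let actR : MulAction Γ D :=
    { smul := fun l ω => ⟨l • (ω : S.Ω), hr1 l _ ω.2⟩
      one_smul := fun ω => Subtype.ext (one_smul Γ (ω : S.Ω))
      mul_smul := fun a b ω => Subtype.ext (mul_smul a b (ω : S.Ω)) }
  have exX : ∀ ω : D, ∃! g : Γ, g • ω ∈ (Subtype.val ⁻¹' S.X : Set D) := fun ω => by
    have := (ω.2 1 1).1
    simp only [one_smul] at this
    exact this
  have exY : ∀ ω : D, ∃! g : Λ, g • ω ∈ (Subtype.val ⁻¹' S.Y : Set D) := fun ω => by
    have := (ω.2 1 1).2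
    simp only [one_smul] at this
    exact this
  have mX : S.μ.comap (Subtype.val : D → S.Ω) (Subtype.val ⁻¹' S.X) = S.μ S.X := by
    rw [measure_comap_val_preimage hD, measure_inter_conull hD0]
  have mY : S.μ.comap (Subtype.val : D → S.Ω) (Subtype.val ⁻¹' S.Y) = S.μ S.Y := by
    rw [measure_comap_val_preimage hD, measure_inter_conull hD0]
  have measX : MeasurableSet (Subtype.val ⁻¹' S.X : Set D) :=
    measurable_subtype_coe S.measurableSet_X
  have measY : MeasurableSet (Subtype.val ⁻¹' S.Y : Set D) :=
    measurable_subtype_coe S.measurableSet_Y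
  refine ⟨{
    Ω := D
    standardBorel := hD.standardBorel
    μ := S.μ.comap Subtype.val
    actionLeft := actL
    actionRight := actR
    commute := ⟨fun a b ω => Subtype.ext (smul_comm a b (ω : S.Ω))⟩
    measurePreserving_left := fun l => (S.measurePreserving_left l).subtype_of_iff hD (hl l)
    measurePreserving_right := fun l => (S.measurePreserving_right l).subtype_of_iff hD (hr l)
    X := Subtype.val ⁻¹' S.X
    Y := Subtype.val ⁻¹' S.Y
    measurableSet_X := measX
    measurableSet_Y := measY
    isFundamentalDomain_X := .mk' measX.nullMeasurableSet exX
    isFundamentalDomain_Y := .mk' measY.nullMeasurableSet exY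
    subset := Set.preimage_mono S.subset
    measure_X_ne_zero := mX ▸ S.measure_X_ne_zero
    measure_X_ne_top := mX ▸ S.measure_X_ne_top }, ⟨exX, exY⟩, ?_, fun h => ?_⟩
  · simp only [index, mX, mY]
  · simp only [h]

/-- If the index is `1`, then `Y` may be replaced by `X`. -/
theorem exists_Y_eq_X [Countable Λ] (S : SMICoupling Λ Γ) (h : S.index = 1) :
    ∃ T : SMICoupling Λ Γ, T.Y = T.X := by
  have hXY : S.μ S.Y = S.μ S.X := by
    rw [index, ENNReal.div_eq_one_iff S.measure_X_ne_zero S.measure_X_ne_top] at h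
    exact h
  have hae : S.X =ᵐ[S.μ] S.Y := ae_eq_of_subset_of_measure_ge S.subset hXY.le
    S.measurableSet_X.nullMeasurableSet (hXY ▸ S.measure_X_ne_top)
  refine ⟨{ S with
    Y := S.X
    measurableSet_Y := S.measurableSet_X
    subset := le_rfl
    isFundamentalDomain_Y := ?_ }, rfl⟩
  have hsub := S.subset
  refine ⟨S.measurableSet_X.nullMeasurableSet, ?_, fun a b hab =>
    (S.isFundamentalDomain_Y.aedisjoint hab).mono (Set.smul_set_mono hsub)
      (Set.smul_set_mono hsub)⟩
  have h1 : ∀ᵐ ω ∂S.μ, ∀ l : Λ, l • ω ∈ S.X ↔ l • ω ∈ S.Y := by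
    rw [ae_all_iff]
    exact fun l => (S.measurePreserving_left l).quasiMeasurePreserving.ae hae.mem_iff
  filter_upwards [S.isFundamentalDomain_Y.ae_covers, h1] with ω ⟨l, hl⟩ hω
  exact ⟨l, (hω l).2 hl⟩

end SMICoupling

/-! ### Invariance of the measure under skew actions -/

section SkewMeasure

variable {Ω A B M : Type*} [Group A] [Group B] [Group M] [MulAction A Ω] [MulAction B Ω]
  {F : Set Ω} [MeasurableSpace Ω] {μ : Measure Ω}

theorem measurable_returnElt_comp {β : Type*} [MeasurableSpace β] [Countable B]
    [MeasurableConstSMul B Ω] (hF : ∀ ω : Ω, ∃! b : B, b • ω ∈ F) (hFm : MeasurableSet F)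
    {f : B → Ω → β} (hf : ∀ b, Measurable (f b)) :
    Measurable fun ω => f (returnElt hF ω) ω := by
  intro E hE
  have : (fun ω => f (returnElt hF ω) ω) ⁻¹' E =
      ⋃ b : B, (fun ω => b • ω) ⁻¹' F ∩ f b ⁻¹' E := by
    ext ω
    simp only [Set.mem_preimage, Set.mem_iUnion, Set.mem_inter_iff]
    constructor
    · exact fun h => ⟨_, returnElt_smul_mem hF ω, h⟩
    · rintro ⟨b, h1, h2⟩
      rwa [← eq_returnElt hF h1]
  rw [this]
  exact MeasurableSet.iUnion fun b => (measurable_const_smul b hFm).inter (hf b hE)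

theorem measurable_returnMap [Countable B] [MeasurableConstSMul B Ω] [MeasurableConstSMul A Ω]
    (hF : ∀ ω : Ω, ∃! b : B, b • ω ∈ F) (hFm : MeasurableSet F) (a : A) :
    Measurable (returnMap hF a) :=
  (((measurable_returnElt_comp hF hFm (f := fun b ω => b • ω)
    fun b => measurable_const_smul b).comp (measurable_const_smul a)).comp
      measurable_subtype_coe).subtype_mk

/-- Let `r : Ω → F` be the projection along `B`-orbits. The return map is `x ↦ r (a x)`, so the
preimage of `E` is the translate by `a⁻¹` of `r⁻¹ E ∩ a F`. Since `a F` is again a fundamental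
domain for `B`, the `B`-invariant set `r⁻¹ E` has the same measure in `a F` as in `F`. -/
theorem measurePreserving_returnMap [Countable B] [MeasurableConstSMul B Ω]
    [MeasurableConstSMul A Ω] [SMulInvariantMeasure A Ω μ] [SMulInvariantMeasure B Ω μ]
    [SMulCommClass A B Ω]
    (hF : ∀ ω : Ω, ∃! b : B, b • ω ∈ F) (hFm : MeasurableSet F) (a : A) :
    MeasurePreserving (returnMap hF a) (μ.comap Subtype.val) (μ.comap Subtype.val) := by
  have hm := measurable_returnMap (A := A) hF hFm
  refine ⟨hm a, Measure.ext fun E hE => ?_⟩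
  let r : Ω → F := fun ω => ⟨returnElt hF ω • ω, returnElt_smul_mem hF ω⟩
  have hr : Measurable r := (measurable_returnElt_comp hF hFm (f := fun b ω => b • ω)
    fun b => measurable_const_smul b).subtype_mk
  have hrb : ∀ (b : B) ω, r (b • ω) = r ω := by
    intro b ω
    have : returnElt hF (b • ω) * b = returnElt hF ω :=
      eq_returnElt hF (by rw [mul_smul]; exact returnElt_smul_mem hF _)
    refine Subtype.ext ?_
    simp only [r]
    rw [← this, mul_smul]
  have hrF : ∀ x : F, r x = x := by
    intro x
    have : (1 : B) = returnElt hF (x : Ω) := eq_returnElt hF (by simp)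
    refine Subtype.ext ?_
    simp only [r]
    rw [← this, one_smul]
  have hinv : ∀ b : B, (fun ω => b • ω) ⁻¹' (r ⁻¹' E) = r ⁻¹' E := by
    intro b; ext ω; simp only [Set.mem_preimage, hrb]
  let F' : Set Ω := (fun ω => a⁻¹ • ω) ⁻¹' F
  have hF' : ∀ ω : Ω, ∃! b : B, b • ω ∈ F' := by
    intro ω
    obtain ⟨b, h1, h2⟩ := hF (a⁻¹ • ω)
    simp only [F', Set.mem_preimage, smul_comm a⁻¹]
    exact ⟨b, h1, h2⟩
  have key := IsFundamentalDomain.measure_set_eq (μ := μ)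
    (.mk' hFm.nullMeasurableSet hF)
    (.mk' (measurable_const_smul a⁻¹ hFm).nullMeasurableSet hF') (hr hE) hinv
  rw [Measure.map_apply (hm a) hE, comap_subtype_coe_apply hFm, comap_subtype_coe_apply hFm]
  have e1 : Subtype.val '' E = r ⁻¹' E ∩ F := by
    ext ω
    constructor
    · rintro ⟨x, hx, rfl⟩
      exact ⟨by rwa [Set.mem_preimage, hrF], x.2⟩
    · rintro ⟨h1, h2⟩
      exact ⟨⟨ω, h2⟩, by rwa [Set.mem_preimage, hrF ⟨ω, h2⟩] at h1, rfl⟩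
  have e2 : Subtype.val '' (returnMap hF a ⁻¹' E) =
      (fun ω => a • ω) ⁻¹' (r ⁻¹' E ∩ F') := by
    ext ω
    constructor
    · rintro ⟨x, hx, rfl⟩
      refine ⟨hx, ?_⟩
      simp [F']
    · rintro ⟨h1, h2⟩
      simp only [F', Set.mem_preimage, inv_smul_smul] at h2
      exact ⟨⟨ω, h2⟩, h1, rfl⟩
  rw [e1, e2, measure_preimage_smul, key]

variable [MeasurableSpace M] [Countable M] [DiscreteMeasurableSpace M]

theorem measurePreserving_skewHom [Countable B] [MeasurableConstSMul B Ω]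
    [MeasurableConstSMul A Ω] [SMulInvariantMeasure A Ω μ] [SMulInvariantMeasure B Ω μ]
    [SMulCommClass A B Ω] [IsFiniteMeasure (μ.comap (Subtype.val : F → Ω))]
    (hF : ∀ ω : Ω, ∃! b : B, b • ω ∈ F) (hFm : MeasurableSet F) (ι : B →* M) (a : A) :
    MeasurePreserving (skewHom hF ι a) ((μ.comap Subtype.val).prod Measure.count)
      ((μ.comap Subtype.val).prod Measure.count) := by
  have hc : Measurable fun x : F => (ι (returnElt hF (a • (x : Ω))))⁻¹ :=
    ((measurable_returnElt_comp hF hFm (f := fun b _ => (ι b)⁻¹)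
      fun b => measurable_const).comp (measurable_const_smul a)).comp measurable_subtype_coe
  refine (measurePreserving_returnMap (A := A) hF hFm a).skew_product
    (g := fun x m => m * (ι (returnElt hF (a • (x : Ω))))⁻¹) ?_ (ae_of_all _ fun x => ?_)
  · exact (Measurable.of_discrete (f := fun p : M × M => p.1 * p.2)).comp
      (measurable_snd.prodMk (hc.comp measurable_fst))
  · exact map_mul_right_eq_self _ _

theorem measurePreserving_rightHom {X : Type*} [MeasurableSpace X] (ν : Measure X)
    [IsFiniteMeasure ν] (j : A →* M) (a : A) :
    MeasurePreserving (rightHom X j a) (ν.prod Measure.count) (ν.prod Measure.count) := by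
  refine (MeasurePreserving.id ν).skew_product
    (g := fun x m => m * (j a)⁻¹) ?_ (ae_of_all _ fun x => ?_)
  · exact (Measurable.of_discrete (f := fun m : M => m * (j a)⁻¹)).comp measurable_snd
  · exact map_mul_right_eq_self _ _

theorem GraphProduct.measurePreserving_skew {V : Type*} {Θ : SimpleGraph V} {A B : V → Type*}
    [∀ v, Group (A v)] [∀ v, Group (B v)] {w : V} [MulAction (A w) Ω] [MulAction (B w) Ω]
    [SMulCommClass (A w) (B w) Ω] [Countable (B w)] [MeasurableConstSMul (B w) Ω]
    [MeasurableConstSMul (A w) Ω] [SMulInvariantMeasure (A w) Ω μ]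
    [SMulInvariantMeasure (B w) Ω μ] [IsFiniteMeasure (μ.comap (Subtype.val : F → Ω))]
    (hF : ∀ ω : Ω, ∃! b : B w, b • ω ∈ F) (hFm : MeasurableSet F) (φ : ∀ v, A v →* B v)
    (k : ∀ v, B v →* M) (hk : ∀ u v, Θ.Adj u v → ∀ a b, Commute (k u a) (k v b))
    (h : GraphProduct Θ A) :
    MeasurePreserving (skew hF φ k hk h) ((μ.comap Subtype.val).prod Measure.count)
      ((μ.comap Subtype.val).prod Measure.count) := by
  induction h using induction_on with
  | one => rw [map_one]; exact MeasurePreserving.id _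
  | of v a =>
    by_cases hv : v = w
    · subst hv
      rw [skew_of_self]
      exact measurePreserving_skewHom hF hFm _ a
    · rw [skew_of_ne hF φ k hk hv]
      exact measurePreserving_rightHom _ _ a
  | mul a b ha hb => rw [map_mul]; exact ha.comp hb

end SkewMeasure

/-! ### From a free skew action to a coupling -/

section Construction

theorem Function.exists_forall_apply_le {ι : Type*} [Nonempty ι] (f : ι → ℕ) :
    ∃ i, ∀ j, f i ≤ f j := by
  obtain ⟨_, ⟨i, rfl⟩, hi⟩ := wellFounded_lt.has_min (Set.range f) (Set.range_nonempty f)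
  exact ⟨i, fun j => not_lt.1 (hi _ ⟨j, rfl⟩)⟩

theorem exists_injective_nat_apply_eq_zero {α : Type*} [Countable α] (a : α) :
    ∃ f : α → ℕ, Function.Injective f ∧ f a = 0 := by
  obtain ⟨f, hf⟩ := exists_injective_nat α
  refine ⟨Equiv.swap (f a) 0 ∘ f, (Equiv.injective _).comp hf, by simp⟩

open scoped Pointwise

/-- A measure preserving action of `Λ` on `X × Γ` that commutes with the left translations by `Γ`
and for which no nontrivial element maps a point of `X × {1}` into `X × {1}` defines a coupling. -/
theorem exists_coupling_of_skew {Λ Γ' : Type*} [Group Λ] [Group Γ'] [Countable Λ] {X Γ : Type}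
    [MeasurableSpace X] [StandardBorelSpace X] (μ : Measure X) [IsFiniteMeasure μ]
    (hμ : μ Set.univ ≠ 0)
    [Group Γ] [Countable Γ] [MeasurableSpace Γ] [DiscreteMeasurableSpace Γ] (e : Γ' ≃* Γ)
    (σ : Λ →* Equiv.Perm (X × Γ))
    (hσ : ∀ h x n m, σ h (x, n * m) = ((σ h (x, m)).1, n * (σ h (x, m)).2))
    (hmp : ∀ h, MeasurePreserving (σ h) (μ.prod Measure.count) (μ.prod Measure.count))
    (hfree : ∀ h x y, σ h (x, 1) = (y, 1) → h = 1) :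
    ∃ T : SMICoupling Λ Γ', (Infinite Γ → T.μ Set.univ = ∞) ∧
      ((∀ p, ∃ h, (σ h p).2 = 1) → T.index = 1) ∧
      ∀ E, MeasurableSet E → (∀ h, ∀ p ∈ E, σ h p ∈ E → h = 1) →
        (μ.prod (Measure.count : Measure Γ)) E = ∞ → T.index = ∞ := by
  have : Countable Γ' := e.injective.countable
  let ν : Measure (X × Γ) := μ.prod Measure.count
  let actL : MulAction Λ (X × Γ) := MulAction.compHom (X × Γ) σ
  let actR : MulAction Γ' (X × Γ) :=
    { smul := fun g p => (p.1, e g * p.2)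
      one_smul := fun p => Prod.ext rfl (show e 1 * p.2 = p.2 by simp)
      mul_smul := fun a b p => Prod.ext rfl
        (show e (a * b) * p.2 = e a * (e b * p.2) by simp [mul_assoc]) }
  have hmpL : ∀ l : Λ, MeasurePreserving (fun p : X × Γ => l • p) ν ν := hmp
  have hmpR : ∀ g : Γ', MeasurePreserving (fun p : X × Γ => g • p) ν ν := by
    intro g
    refine (MeasurePreserving.id μ).skew_product (g := fun x m => e g * m) ?_
      (ae_of_all _ fun x => map_mul_left_eq_self _ _)
    exact (Measurable.of_discrete (f := fun m : Γ => e g * m)).comp measurable_snd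
  have : SMulInvariantMeasure Λ (X × Γ) ν :=
    ⟨fun l s hs => (hmpL l).measure_preimage hs.nullMeasurableSet⟩
  have : MeasurableConstSMul Λ (X × Γ) := ⟨fun l => (hmpL l).measurable⟩
  obtain ⟨enc, henc, henc1⟩ := exists_injective_nat_apply_eq_zero (1 : Γ)
  have hfree' : ∀ h p, (σ h p).2 = p.2 → h = 1 := by
    rintro h ⟨x, g⟩ hp
    have h1 := hσ h x g 1
    rw [mul_one] at h1
    rw [h1] at hp
    exact hfree h x (σ h (x, 1)).1 (Prod.ext rfl (by simpa using hp))
  let X' : Set (X × Γ) := Set.univ ×ˢ {1}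
  -- The points whose `Γ`-coordinate has the least code along the `Λ`-orbit. The minimum is attained
  -- in `ℕ`, at only one group element by `hfree'` and injectivity of `enc`; `enc 1 = 0` puts `X'`
  -- inside `Y'`.
  let Y' : Set (X × Γ) := {p | ∀ h : Λ, enc p.2 ≤ enc (σ h p).2}
  have mX : MeasurableSet X' := MeasurableSet.univ.prod (measurableSet_singleton _)
  have mY : MeasurableSet Y' := by
    simp only [Y', Set.ofPred_forall]
    refine MeasurableSet.iInter fun h => measurableSet_le ?_ ?_
    · exact (Measurable.of_discrete (f := enc)).comp measurable_snd
    · exact (Measurable.of_discrete (f := enc)).comp (measurable_snd.comp (hmp h).measurable)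
  have hX : ν X' = μ Set.univ := by
    simp [ν, X', Measure.prod_prod]
  have exX : ∀ p : X × Γ, ∃! g : Γ', g • p ∈ X' := by
    intro p
    have hiff : ∀ g : Γ', g • p ∈ X' ↔ e g * p.2 = 1 := fun g => by
      change (p.1, e g * p.2) ∈ X' ↔ _
      simp [X']
    simp only [hiff]
    refine ⟨e.symm p.2⁻¹, by simp, fun g hg => ?_⟩
    rw [← eq_inv_of_mul_eq_one_left hg, e.symm_apply_apply]
  have exY : ∀ p : X × Γ, ∃! h : Λ, h • p ∈ Y' := by
    intro p
    obtain ⟨h, hh⟩ := Function.exists_forall_apply_le fun h : Λ => enc (σ h p).2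
    have hiff : ∀ k : Λ, k • p ∈ Y' ↔ ∀ j, enc (σ k p).2 ≤ enc (σ j p).2 := by
      intro k
      change (∀ j, enc (σ k p).2 ≤ enc (σ j (σ k p)).2) ↔ _
      constructor
      · intro H j
        simpa using H (j * k⁻¹)
      · intro H j
        simpa using H (j * k)
    simp only [hiff]
    refine ⟨h, hh, fun k hk => ?_⟩
    have h1 := henc (le_antisymm (hk h) (hh k))
    have : k * h⁻¹ = 1 := hfree' _ (σ h p) (by simpa using h1)
    exact mul_inv_eq_one.1 this
  have fdY : IsFundamentalDomain Λ Y' ν := .mk' mY.nullMeasurableSet exY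
  have hsub : X' ⊆ Y' := by
    rintro ⟨x, g⟩ ⟨-, hg⟩ h
    rw [Set.mem_singleton_iff] at hg
    simp only at hg
    simp [hg, henc1]
  refine ⟨{
    Ω := X × Γ
    μ := ν
    actionLeft := actL
    actionRight := actR
    commute := ⟨fun l g p => by
      obtain ⟨x, m⟩ := p
      exact hσ l x (e g) m⟩
    measurePreserving_left := hmpL
    measurePreserving_right := hmpR
    X := X'
    Y := Y'
    measurableSet_X := mX
    measurableSet_Y := mY
    isFundamentalDomain_X := .mk' mX.nullMeasurableSet exX
    isFundamentalDomain_Y := fdY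
    subset := hsub
    measure_X_ne_zero := hX ▸ hμ
    measure_X_ne_top := hX ▸ measure_ne_top μ _ }, fun hinf => ?_, fun hsurj => ?_,
    fun E mE hE hEtop => ?_⟩
  · change ν Set.univ = ∞
    rw [← Set.univ_prod_univ, Measure.prod_prod, Measure.count_apply_infinite Set.infinite_univ]
    exact ENNReal.mul_top hμ
  · have : Y' = X' := by
      refine Set.Subset.antisymm ?_ hsub
      rintro p hp
      obtain ⟨h, hh⟩ := hsurj p
      have := hp h
      rw [hh, henc1] at this
      exact ⟨trivial, henc (by rw [henc1]; omega)⟩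
    change ν Y' / ν X' = 1
    rw [this, hX]
    exact ENNReal.div_self hμ (measure_ne_top μ _)
  · change ν Y' / ν X' = ∞
    -- The translates of `E` are disjoint, so `E` is no larger than a fundamental domain.
    have hle : ν E ≤ ν Y' := by
      refine fdY.measure_le_of_pairwise_disjoint mE.nullMeasurableSet fun a b hab => ?_
      refine Disjoint.aedisjoint (Set.disjoint_left.2 ?_)
      rintro p ⟨h1, -⟩ ⟨h2, -⟩
      rw [Set.mem_smul_set_iff_inv_smul_mem] at h1 h2
      have := hE (b⁻¹ * a) (a⁻¹ • p) h1 (by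
        change (b⁻¹ * a) • a⁻¹ • p ∈ E
        rwa [smul_smul, mul_assoc, mul_inv_cancel, mul_one])
      exact hab (inv_mul_eq_one.1 this).symm
    have hEtop' : ν E = ∞ := hEtop
    rw [hEtop', top_le_iff] at hle
    rw [hle, hX]
    exact ENNReal.top_div_of_ne_top (measure_ne_top μ _)

end Construction

/-! ### Return maps and piecewise actions -/

section Return

variable {Ω A B : Type*} [Group A] [Group B] [MulAction A Ω] [MulAction B Ω]
  {F : Set Ω} [SMulCommClass A B Ω] (hF : ∀ ω : Ω, ∃! b : B, b • ω ∈ F)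

theorem returnMap_one (x : F) : returnMap hF (1 : A) x = x :=
  congrArg Prod.fst ((skewAction (A := A) hF (1 : B →* B)).one_smul (x, 1))

theorem returnMap_mul (a a' : A) (x : F) :
    returnMap hF (a * a') x = returnMap hF a (returnMap hF a' x) :=
  congrArg Prod.fst ((skewAction (A := A) hF (1 : B →* B)).mul_smul a a' (x, 1))

omit [SMulCommClass A B Ω] in
theorem returnMap_eq {a : A} {b : B} {x y : F} (h : b • a • (x : Ω) = y) :
    returnMap hF a x = y := by
  have hb : b = returnElt hF (a • (x : Ω)) := eq_returnElt hF (h ▸ y.2)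
  exact Subtype.ext (by simp only [returnMap]; rw [← hb, h])

end Return

open Classical in
/-- The action that is given by `f` where `P` holds and by `g` elsewhere. -/
noncomputable def piecewisePermHom {A Z : Type*} [Group A] (P : Z → Prop) (f g : A → Z → Z)
    (f_one : ∀ z, f 1 z = z) (g_one : ∀ z, g 1 z = z)
    (f_mul : ∀ a b z, f (a * b) z = f a (f b z)) (g_mul : ∀ a b z, g (a * b) z = g a (g b z))
    (hf : ∀ a z, P z → P (f a z)) (hg : ∀ a z, ¬ P z → ¬ P (g a z)) : A →* Equiv.Perm Z :=
  letI : MulAction A Z :=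
    { smul := fun a z => if P z then f a z else g a z
      one_smul := fun z => by
        change (if P z then f 1 z else g 1 z) = z
        rw [f_one, g_one, ite_self]
      mul_smul := fun a b z => by
        change (if P z then f (a * b) z else g (a * b) z) =
          if P (if P z then f b z else g b z) then f a (if P z then f b z else g b z) else
            g a (if P z then f b z else g b z)
        by_cases h : P z
        · simp only [if_pos h, if_pos (hf b z h), f_mul]
        · simp only [if_neg h, if_neg (hg b z h), g_mul] }
  MulAction.toPermHom A Z

section

variable {A Z : Type*} [Group A] {P : Z → Prop} {f g : A → Z → Z}
    {f_one : ∀ z, f 1 z = z} {g_one : ∀ z, g 1 z = z}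
    {f_mul : ∀ a b z, f (a * b) z = f a (f b z)} {g_mul : ∀ a b z, g (a * b) z = g a (g b z)}
    {hf : ∀ a z, P z → P (f a z)} {hg : ∀ a z, ¬ P z → ¬ P (g a z)}

theorem piecewisePermHom_of_pos (a : A) {z : Z} (h : P z) :
    piecewisePermHom P f g f_one g_one f_mul g_mul hf hg a z = f a z := by
  classical
  exact if_pos h

theorem piecewisePermHom_of_neg (a : A) {z : Z} (h : ¬ P z) :
    piecewisePermHom P f g f_one g_one f_mul g_mul hf hg a z = g a z := by
  classical
  exact if_neg h

end

/-! ### The induced action: freeness, orbits, separated translates -/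

namespace GraphProduct

variable {V : Type*} {Θ : SimpleGraph V}

section Pair

variable {A : V → Type*} [∀ v, Group (A v)] {v w : V} {N : Type*} [Group N]

open Classical in
/-- For nonadjacent `v ≠ w`, the homomorphism that is given on `A v` and `A w` and kills the other
vertex groups. -/
noncomputable def liftPair (hvw : v ≠ w) (hadj : ¬ Θ.Adj v w) (f : A v →* N) (g : A w →* N) :
    GraphProduct Θ A →* N :=
  lift (Function.update (Function.update (fun _ => 1) v f) w g) (by
    have h1 : ∀ u, u ≠ v → u ≠ w →
        Function.update (Function.update (fun u => (1 : A u →* N)) v f) w g u = 1 :=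
      fun u h h' => by rw [Function.update_of_ne h', Function.update_of_ne h]
    intro u u' huu a b
    by_cases hu : u ≠ v ∧ u ≠ w
    · rw [h1 u hu.1 hu.2]; exact Commute.one_left _
    · by_cases hu' : u' ≠ v ∧ u' ≠ w
      · rw [h1 u' hu'.1 hu'.2]; exact Commute.one_right _
      · exfalso
        have e1 : u = v ∨ u = w := by tauto
        have e2 : u' = v ∨ u' = w := by tauto
        rcases e1 with rfl | rfl <;> rcases e2 with rfl | rfl
        · exact huu.ne rfl
        · exact hadj huu
        · exact hadj huu.symm
        · exact huu.ne rfl)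

variable (hvw : v ≠ w) (hadj : ¬ Θ.Adj v w) (f : A v →* N) (g : A w →* N)

theorem liftPair_left (a : A v) : liftPair hvw hadj f g (of Θ v a) = f a := by
  classical
  rw [liftPair, lift_of, Function.update_of_ne hvw, Function.update_self]

theorem liftPair_right (a : A w) : liftPair hvw hadj f g (of Θ w a) = g a := by
  classical
  rw [liftPair, lift_of, Function.update_self]

theorem liftPair_of_ne {u : V} (hv : u ≠ v) (hw : u ≠ w) (a : A u) :
    liftPair hvw hadj f g (of Θ u a) = 1 := by
  classical
  rw [liftPair, lift_of, Function.update_of_ne hw, Function.update_of_ne hv]; rfl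

include hvw hadj in
-- The elements `(s t)ⁿ s` stay distinct in the free product, onto which the two nonadjacent vertex
-- groups map as free factors. This makes the coupling space infinite in measure.
theorem infinite_of_not_adj [Nontrivial (A v)] [Nontrivial (A w)] :
    Infinite (GraphProduct Θ A) := by
  obtain ⟨s, hs⟩ := exists_ne (1 : A v)
  obtain ⟨t, ht⟩ := exists_ne (1 : A w)
  let π : GraphProduct Θ A →* Monoid.CoprodI A :=
    liftPair hvw hadj Monoid.CoprodI.of Monoid.CoprodI.of
  refine Infinite.of_injective (fun n : ℕ => (of Θ v s * of Θ w t) ^ n * of Θ v s)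
    fun m n h => Monoid.CoprodI.injective_pow_mul_coset hvw hs ht ?_
  have := congrArg π h
  simp only [map_mul, map_pow, π, liftPair_left, liftPair_right] at this
  simp only [this]

end Pair

variable {A B : V → Type*} [∀ v, Group (A v)] [∀ v, Group (B v)]
  {w : V} {Ω Γ : Type*} [Group Γ] [MulAction (A w) Ω] [MulAction (B w) Ω]
  [SMulCommClass (A w) (B w) Ω] {X Y : Set Ω}

/-- The action of the graph product of the `A v` on `X × Γ`, where `Γ` is isomorphic to the graph
product of the `B v`. -/
noncomputable def inducedAction (hX : ∀ ω : Ω, ∃! b : B w, b • ω ∈ X) (φ : ∀ v, A v →* B v)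
    (e : GraphProduct Θ B ≃* Γ) : GraphProduct Θ A →* Equiv.Perm (X × Γ) :=
  skew hX φ (fun v => e.toMonoidHom.comp (of Θ v)) fun _ _ h a b =>
    (commute_of h a b).map e.toMonoidHom

variable (hX : ∀ ω : Ω, ∃! b : B w, b • ω ∈ X) (hY : ∀ ω : Ω, ∃! a : A w, a • ω ∈ Y)
  (φ : ∀ v, A v →* B v) (e : GraphProduct Θ B ≃* Γ)

theorem inducedAction_mul_left (h : GraphProduct Θ A) (x : X) (n m : Γ) :
    inducedAction hX φ e h (x, n * m) =
      ((inducedAction hX φ e h (x, m)).1, n * (inducedAction hX φ e h (x, m)).2) :=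
  skew_mul_left ..

theorem inducedAction_of_self (a : A w) (x : X) (m : Γ) :
    inducedAction hX φ e (of Θ w a) (x, m) =
      (returnMap hX a x, m * (e (of Θ w (returnElt hX (a • (x : Ω)))))⁻¹) := by
  rw [inducedAction, skew_of_self]; rfl

theorem inducedAction_of_ne {v : V} (hv : v ≠ w) (a : A v) (x : X) (m : Γ) :
    inducedAction hX φ e (of Θ v a) (x, m) = (x, m * (e (of Θ v (φ v a)))⁻¹) := by
  rw [inducedAction, skew_of_ne _ _ _ _ hv]; rfl

include hY in
-- The graph product of the `B v` acts on `Y × GraphProduct Θ A` through returns to `Y`. The orbit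
-- map `(x, m) ↦ m • (x, 1)` carries `h` to left multiplication by `h`, so `(x, 1) ↦ (y, 1)` yields
-- `(y, 1) = (x, h)`.
theorem eq_one_of_inducedAction_eq (hXY : X ⊆ Y) (ψ : ∀ v, B v →* A v)
    (hψφ : ∀ v, v ≠ w → ∀ a, ψ v (φ v a) = a) (h : GraphProduct Θ A) (x y : X)
    (hxy : inducedAction hX φ e h (x, 1) = (y, 1)) : h = 1 := by
  have : SMulCommClass (B w) (A w) Ω := SMulCommClass.symm _ _ _
  let τ₀ : GraphProduct Θ B →* Equiv.Perm (Y × GraphProduct Θ A) :=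
    inducedAction hY ψ (MulEquiv.refl _)
  let ρ : GraphProduct Θ A →* Equiv.Perm (Y × GraphProduct Θ A) :=
    { toFun := fun a => Equiv.prodCongr (Equiv.refl _) (Equiv.mulLeft a)
      map_one' := by ext <;> simp
      map_mul' := fun a b => by ext <;> simp [mul_assoc] }
  have key := orbitMap_equivariant (inducedAction hX φ e) (inducedAction_mul_left hX φ e)
    (τ₀.comp e.symm.toMonoidHom) ρ (fun m h z => ?_)
    (fun x => (⟨x, hXY x.2⟩, 1)) (fun v a x => ?_) h (x, 1)
  · rw [hxy] at key
    simp only [map_one, Equiv.Perm.one_apply] at key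
    have := congrArg Prod.snd key
    simpa [ρ] using this.symm
  · exact inducedAction_mul_left hY ψ _ _ z.1 h z.2
  · by_cases hv : v = w
    · subst hv
      rw [inducedAction_of_self]
      simp only [one_mul, MonoidHom.comp_apply, MulEquiv.toMonoidHom_eq_coe, MonoidHom.coe_coe,
        map_inv, MulEquiv.symm_apply_apply]
      rw [← map_inv, ← map_inv]
      simp only [τ₀, inducedAction]
      -- If `r` returns `a x` to `X`, then `r⁻¹` takes the returned point back to `a x`, and `a⁻¹`
      -- brings this to `x ∈ Y`. Hence the cocycle into `A w` is `a⁻¹`, and the second coordinate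
      -- becomes `a`.
      rw [skew_of_self, skewHom_eq hY _ (b := a⁻¹) (y := ⟨x, hXY x.2⟩)]
      · simp [ρ]
      · simp [returnMap]
    · rw [inducedAction_of_ne _ _ _ hv]
      simp only [one_mul, MonoidHom.comp_apply, MulEquiv.toMonoidHom_eq_coe, MonoidHom.coe_coe,
        map_inv, MulEquiv.symm_apply_apply]
      rw [← map_inv, ← map_inv, inducedAction_of_ne _ _ _ hv]
      simp [ρ, hψφ v hv]

include hY in
-- The letters of the second coordinate can be removed from the right one at a time. For a letter `b
-- ∈ B w`, the return of `b x` to `Y = X` by some `a ∈ A w` shows that `b` returns `a x` to `X`, so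
-- acting by `a` cancels `b`.
theorem exists_inducedAction_snd_eq_one (hXY : Y = X) (ψ : ∀ v, B v →* A v)
    (hφψ : ∀ v, v ≠ w → ∀ b, φ v (ψ v b) = b) (p : X × Γ) :
    ∃ h, (inducedAction hX φ e h p).2 = 1 := by
  suffices H : ∀ (g : GraphProduct Θ B) (x : X) (m : Γ), ∃ h y,
      inducedAction hX φ e h (x, m * e g) = (y, m) by
    obtain ⟨x, m⟩ := p
    obtain ⟨h, y, hy⟩ := H (e.symm m) x 1
    rw [e.apply_symm_apply, one_mul] at hy
    exact ⟨h, congrArg Prod.snd hy⟩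
  intro g
  induction g using induction_on with
  | one => exact fun x m => ⟨1, x, by simp⟩
  | of v b =>
    intro x m
    by_cases hv : v = w
    · subst hv
      obtain ⟨a, ha, -⟩ := hY (b • (x : Ω))
      rw [hXY, smul_comm] at ha
      refine ⟨of Θ v a, ⟨_, ha⟩, ?_⟩
      rw [inducedAction, skew_of_self, skewHom_eq hX _ (b := b) (y := ⟨_, ha⟩) rfl]
      simp
    · refine ⟨of Θ v (ψ v b), x, ?_⟩
      rw [inducedAction_of_ne _ _ _ hv, hφψ v hv]
      simp
  | mul g g' hg hg' =>
    intro x m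
    obtain ⟨h, y, hy⟩ := hg' x (m * e g)
    obtain ⟨h', y', hy'⟩ := hg y m
    exact ⟨h' * h, y', by rw [map_mul, Equiv.Perm.mul_apply, map_mul, ← mul_assoc, hy, hy']⟩

include hY in
-- An action `τ` on `Y × C`, with `C` the cosets of `B w` in the free product, is chosen so that
-- `(x, m) ↦ τ m (x, o)` is invariant under the induced action. It takes different values on the
-- layers `γ n`: `b` moves `x` into `Y \ X`, where `(s t)ⁿ s` is seen as a translation of `C`.
theorem exists_separated_translates (hXY : X ⊆ Y) {v : V} (hvw : v ≠ w) (hadj : ¬ Θ.Adj v w)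
    [Nontrivial (B v)] [Nontrivial (B w)] (b : B w) :
    ∃ γ : ℕ → Γ, ∀ (h : GraphProduct Θ A) (m n : ℕ) (x y : X), b • (x : Ω) ∈ Y \ X →
      b • (y : Ω) ∈ Y \ X → inducedAction hX φ e h (x, γ m) = (y, γ n) → m = n := by
  have : SMulCommClass (B w) (A w) Ω := SMulCommClass.symm _ _ _
  obtain ⟨s, hs⟩ := exists_ne (1 : B v)
  obtain ⟨t, ht⟩ := exists_ne (1 : B w)
  have inj := Monoid.CoprodI.injective_pow_mul_coset hvw hs ht
  let i (u : V) : B u →* Monoid.CoprodI B := Monoid.CoprodI.of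
  let C := Monoid.CoprodI B ⧸ (i w).range
  let o : C := ((1 : Monoid.CoprodI B) : C)
  have ho : ∀ a : B w, i w a • o = o := fun a => by
    change ((i w a * 1 : Monoid.CoprodI B) : C) = _
    rw [mul_one, QuotientGroup.eq]
    exact ⟨a⁻¹, by simp⟩
  -- Over the base coset `o`, which `B w` fixes, the returns to `Y` are used; elsewhere `B w`
  -- translates cosets.
  let fw : B w →* Equiv.Perm (Y × C) := piecewisePermHom (fun z => z.2 = o)
    (fun a z => (returnMap hY a z.1, z.2)) (fun a z => (z.1, i w a • z.2))
    (fun z => by rw [returnMap_one]) (fun z => by rw [map_one, one_smul])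
    (fun a a' z => by rw [returnMap_mul]) (fun a a' z => by rw [map_mul, mul_smul])
    (fun a z hz => hz) (fun a z hz h => hz (by
      have h' : i w a • z.2 = o := h
      rw [← ho a] at h'
      exact smul_left_cancel _ h'))
  -- Triviality over `X` gives the invariance of the orbit map; translation over `Y \ X` gives the
  -- separation.
  let fv : B v →* Equiv.Perm (Y × C) := piecewisePermHom (fun z => (z.1 : Ω) ∈ X)
    (fun a z => z) (fun a z => (z.1, i v a • z.2))
    (fun z => rfl) (fun z => by rw [map_one, one_smul])
    (fun a a' z => rfl) (fun a a' z => by rw [map_mul, mul_smul])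
    (fun a z hz => hz) (fun a z hz => hz)
  have fw_base : ∀ a y, fw a (y, o) = (returnMap hY a y, o) := fun a y =>
    piecewisePermHom_of_pos a rfl
  have fw_ne : ∀ a y d, d ≠ o → fw a (y, d) = (y, i w a • d) := fun a y d hd =>
    piecewisePermHom_of_neg a hd
  have fv_mem : ∀ a (y : Y) d, (y : Ω) ∈ X → fv a (y, d) = (y, d) := fun a y d hy =>
    piecewisePermHom_of_pos a hy
  have fv_notMem : ∀ a (y : Y) d, (y : Ω) ∉ X → fv a (y, d) = (y, i v a • d) := fun a y d hy =>
    piecewisePermHom_of_neg a hy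
  let τ : GraphProduct Θ B →* Equiv.Perm (Y × C) := liftPair hvw hadj fv fw
  let c : ℕ → C := fun n => ((((i v s * i w t) ^ n * i v s : Monoid.CoprodI B)) : C)
  have hcs : ∀ n, c (n + 1) = i v s • i w t • c n := fun n => by
    change _ = ((i v s * (i w t * ((i v s * i w t) ^ n * i v s)) : Monoid.CoprodI B) : C)
    simp only [c, pow_succ', mul_assoc]
  have hc0 : c 0 = i v s • o := by
    change _ = ((i v s * 1 : Monoid.CoprodI B) : C)
    simp [c]
  -- If `c n = o`, then `c (n + 1) = s o = c 0`, against injectivity. So `fw` acts by translation at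
  -- each `c n`.
  have hco : ∀ n, c n ≠ o := by
    intro n hn
    have h1 := hcs n
    rw [hn, ho, ← hc0] at h1
    exact absurd (inj h1) (Nat.succ_ne_zero n)
  let g : ℕ → GraphProduct Θ B := fun n => (of Θ v s * of Θ w t) ^ n * of Θ v s
  have hg : ∀ n (y : Y), (y : Ω) ∉ X → τ (g n) (y, o) = (y, c n) := by
    intro n y hy
    induction n with
    | zero =>
      simp only [g, pow_zero, one_mul, τ, liftPair_left]
      rw [fv_notMem _ _ _ hy, hc0]
    | succ n ih =>
      have : g (n + 1) = of Θ v s * (of Θ w t * g n) := by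
        simp only [g, pow_succ', mul_assoc]
      rw [this, map_mul, map_mul, Equiv.Perm.mul_apply, Equiv.Perm.mul_apply, ih]
      simp only [τ, liftPair_left, liftPair_right]
      rw [fw_ne _ _ _ (hco n), fv_notMem _ _ _ hy, hcs]
  have hb : ∀ n (x : X) (hx : b • (x : Ω) ∈ Y \ X),
      τ (g n * of Θ w b) (⟨x, hXY x.2⟩, o) = (⟨b • (x : Ω), hx.1⟩, c n) := by
    intro n x hx
    rw [map_mul, Equiv.Perm.mul_apply, ← hg n _ hx.2]
    congr 1
    simp only [τ, liftPair_right]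
    rw [fw_base, returnMap_eq hY (b := 1) (y := ⟨b • (x : Ω), hx.1⟩)]
    simp
  refine ⟨fun n => e (g n * of Θ w b), fun h m n x y hx hy hxy => ?_⟩
  -- The trivial action on the target expresses invariance of the orbit map.
  have key := orbitMap_equivariant (inducedAction hX φ e) (inducedAction_mul_left hX φ e)
    (τ.comp e.symm.toMonoidHom) 1 (fun m h z => rfl)
    (fun x => (⟨x, hXY x.2⟩, o)) (fun u a x => ?_) h (x, e (g m * of Θ w b))
  · rw [hxy] at key
    simp only [MonoidHom.comp_apply, MulEquiv.toMonoidHom_eq_coe, MonoidHom.coe_coe,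
      MulEquiv.symm_apply_apply, hb _ _ hx, hb _ _ hy, MonoidHom.one_apply,
      Equiv.Perm.one_apply] at key
    exact (inj (congrArg Prod.snd key)).symm
  · by_cases hw : u = w
    · subst hw
      rw [inducedAction_of_self]
      simp only [one_mul, MonoidHom.comp_apply, MulEquiv.toMonoidHom_eq_coe, MonoidHom.coe_coe,
        map_inv, MulEquiv.symm_apply_apply]
      rw [← map_inv, ← map_inv]
      simp only [τ, liftPair_right]
      rw [fw_base, returnMap_eq hY (b := a⁻¹) (y := ⟨x, hXY x.2⟩)]
      · simp
      · simp [returnMap]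
    · rw [inducedAction_of_ne _ _ _ hw]
      simp only [one_mul, MonoidHom.comp_apply, MulEquiv.toMonoidHom_eq_coe, MonoidHom.coe_coe,
        map_inv, MulEquiv.symm_apply_apply]
      rw [← map_inv, ← map_inv]
      by_cases hv : u = v
      · subst hv
        simp only [τ, liftPair_left]
        rw [fv_mem _ _ _ x.2]
        simp
      · simp only [τ]
        rw [liftPair_of_ne _ _ _ _ hv hw]
        simp

end GraphProduct

/-! ### Assembling the coupling -/

namespace GraphProduct

attribute [local instance] SMICoupling.actionLeft SMICoupling.actionRight SMICoupling.commute

theorem exists_coupling {V : Type*} [Finite V] {Θ : SimpleGraph V} {H G : V → Type*}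
    [∀ v, Group (H v)] [∀ v, Group (G v)] [∀ v, Nontrivial (G v)]
    [∀ v, Countable (H v)] [∀ v, Countable (G v)] {v w : V} (hvw : v ≠ w) (hadj : ¬ Θ.Adj v w)
    (φ : ∀ v, H v →* G v) (ψ : ∀ v, G v →* H v) (hψφ : ∀ v, v ≠ w → ∀ a, ψ v (φ v a) = a)
    (hφψ : ∀ v, v ≠ w → ∀ a, φ v (ψ v a) = a)
    (S : SMICoupling (H w) (G w)) (hS : S.IsExact) :
    ∃ T : SMICoupling (GraphProduct Θ H) (GraphProduct Θ G),
      T.μ Set.univ = ∞ ∧ (S.Y = S.X → T.index = 1) ∧ (S.μ (S.Y \ S.X) ≠ 0 → T.index = ∞) := by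
  have : Countable (GraphProduct Θ H) := Quotient.mk_surjective.countable
  have : Countable (GraphProduct Θ G) := Quotient.mk_surjective.countable
  have : Infinite (GraphProduct Θ G) := infinite_of_not_adj hvw hadj
  -- The coupling space must live in `Type`, so the countable group is replaced by a small copy.
  let Γ : Type := Shrink.{0} (GraphProduct Θ G)
  let e : GraphProduct Θ G ≃* Γ := Shrink.mulEquiv.symm
  let _ : MeasurableSpace Γ := ⊤
  have : DiscreteMeasurableSpace Γ := ⟨fun _ => trivial⟩
  have : Countable Γ := e.symm.injective.countable
  have : Infinite Γ := Infinite.of_injective e e.injective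
  have : MeasurableConstSMul (H w) S.Ω := ⟨fun l => (S.measurePreserving_left l).measurable⟩
  have : MeasurableConstSMul (G w) S.Ω := ⟨fun l => (S.measurePreserving_right l).measurable⟩
  have : SMulInvariantMeasure (H w) S.Ω S.μ :=
    ⟨fun l s hs => (S.measurePreserving_left l).measure_preimage hs.nullMeasurableSet⟩
  have : SMulInvariantMeasure (G w) S.Ω S.μ :=
    ⟨fun l s hs => (S.measurePreserving_right l).measure_preimage hs.nullMeasurableSet⟩
  have hXm := S.measurableSet_X
  have hYm := S.measurableSet_Y
  have huniv : S.μ.comap (Subtype.val : S.X → S.Ω) Set.univ = S.μ S.X := by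
    rw [comap_subtype_coe_apply hXm, Set.image_univ, Subtype.range_coe]
  have : IsFiniteMeasure (S.μ.comap (Subtype.val : S.X → S.Ω)) :=
    ⟨by rw [huniv]; exact S.measure_X_ne_top.lt_top⟩
  have : StandardBorelSpace S.X := hXm.standardBorel
  obtain ⟨T, h1, h2, h3⟩ := exists_coupling_of_skew (S.μ.comap (Subtype.val : S.X → S.Ω))
    (by rw [huniv]; exact S.measure_X_ne_zero) e (inducedAction hS.1 φ e)
    (inducedAction_mul_left hS.1 φ e) (measurePreserving_skew hS.1 hXm φ _ _)
    (eq_one_of_inducedAction_eq hS.1 hS.2 φ e S.subset ψ hψφ)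
  refine ⟨T, h1 inferInstance,
    fun h => h2 (exists_inducedAction_snd_eq_one hS.1 hS.2 φ e h ψ hφψ), fun h => ?_⟩
  -- Countably many translates of `X` cover `Y \ X`, so one of them meets it in positive measure.
  obtain ⟨b, hb⟩ : ∃ b : G w, S.μ ((fun ω => b⁻¹ • ω) ⁻¹' S.X ∩ (S.Y \ S.X)) ≠ 0 := by
    by_contra! hcon
    refine h (measure_mono_null (fun ω hω => ?_) (measure_iUnion_null hcon))
    obtain ⟨g, hg, -⟩ := hS.1 ω
    exact Set.mem_iUnion.2 ⟨g⁻¹, by simpa using hg, hω⟩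
  let D : Set S.X := {x | b • (x : S.Ω) ∈ S.Y \ S.X}
  have hDm : MeasurableSet D :=
    ((measurable_const_smul b).comp measurable_subtype_coe) (hYm.diff hXm)
  have hD : S.μ.comap Subtype.val D ≠ 0 := by
    rw [comap_subtype_coe_apply hXm]
    rw [← measure_preimage_smul S.μ b] at hb
    convert hb using 2
    ext ω
    simp only [D, Set.mem_image, Set.mem_preimage, Set.mem_inter_iff, inv_smul_smul]
    exact ⟨fun ⟨x, hx, hxω⟩ => hxω ▸ ⟨x.2, hx⟩, fun h => ⟨⟨ω, h.1⟩, h.2, rfl⟩⟩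
  obtain ⟨x₀, hx₀⟩ : D.Nonempty := nonempty_of_measure_ne_zero hD
  obtain ⟨γ, hγ⟩ := exists_separated_translates hS.1 hS.2 φ e S.subset hvw hadj b
  have hγi : Function.Injective γ := fun m n hmn => hγ 1 m n x₀ x₀ hx₀ hx₀ (by simp [hmn])
  -- Elements of the acting group cannot change the layer `γ n` within this set, and by freeness
  -- only the identity preserves a layer at any point.
  refine h3 (D ×ˢ Set.range γ) (hDm.prod .of_discrete) ?_ ?_
  · rintro h ⟨x, _⟩ ⟨hx, m, rfl⟩ ⟨hy, n, hn⟩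
    have hmn : m = n := hγ h m n x _ hx hy (Prod.ext rfl hn.symm)
    have h4 := inducedAction_mul_left hS.1 φ e h x (γ m) 1
    rw [mul_one] at h4
    simp only [h4, ← hmn] at hn
    exact eq_one_of_inducedAction_eq hS.1 hS.2 φ e S.subset ψ hψφ h x _
      (Prod.ext rfl (by simpa using hn))
  · rw [Measure.prod_prod, Measure.count_apply_infinite (Set.infinite_range_of_injective hγi)]
    exact ENNReal.mul_top hD

end GraphProduct

/-- A vertex adjacent to all others would split the graph as the join of that vertex and its
complement. -/
theorem SimpleGraph.IsIrreducible.exists_not_adj {V : Type*} [Nontrivial V] {Θ : SimpleGraph V}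
    (hΘ : Θ.IsIrreducible) (w : V) : ∃ v, v ≠ w ∧ ¬ Θ.Adj v w := by
  by_contra! h
  obtain ⟨v, hv⟩ := exists_ne w
  refine hΘ ⟨{w}ᶜ, {w}, ⟨v, hv⟩, ⟨w, rfl⟩, Set.compl_union_self _, ?_⟩
  rintro s hs _ rfl
  exact h s hs

theorem mainTheorem4 {V : Type*} [Finite V] [Nontrivial V]
    (Θ : SimpleGraph V) (hΘ : Θ.IsIrreducible)
    (H : V → Type*) (G : V → Type*)
    [∀ v, Group (H v)] [∀ v, Group (G v)]
    [∀ v, Nontrivial (H v)] [∀ v, Nontrivial (G v)]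
    [∀ v, Group.FG (H v)] [∀ v, Group.FG (G v)]
    (w : V) (hiso : ∀ v, v ≠ w → Nonempty (H v ≃* G v))
    (c : ℝ≥0∞) (hw : ∃ S : SMICoupling (H w) (G w), S.index = c) :
    ∃ T : SMICoupling (GraphProduct Θ H) (GraphProduct Θ G),
      T.μ Set.univ = ∞ ∧ (c = 1 → T.index = 1) ∧ (c ≠ 1 → T.index = ∞) := by
  have hH : ∀ v, Countable (H v) := fun v => Group.FG.countable (H v)
  have hG : ∀ v, Countable (G v) := fun v => Group.FG.countable (G v)
  obtain ⟨v, hvw, hadj⟩ := hΘ.exists_not_adj w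
  have hpair : ∀ u, ∃ p : (H u →* G u) × (G u →* H u), u ≠ w →
      (∀ a, p.2 (p.1 a) = a) ∧ ∀ a, p.1 (p.2 a) = a := by
    intro u
    by_cases hu : u = w
    -- Trivial placeholders: at `w` the skew action uses the coupling instead of these
    -- homomorphisms.
    · exact ⟨1, fun h => absurd hu h⟩
    · obtain ⟨f⟩ := hiso u hu
      exact ⟨(f.toMonoidHom, f.symm.toMonoidHom), fun _ => ⟨by simp, by simp⟩⟩
  choose p hp using hpair
  have main := fun S hS => GraphProduct.exists_coupling (Θ := Θ) hvw hadj (fun u => (p u).1)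
    (fun u => (p u).2) (fun u hu => (hp u hu).1) (fun u hu => (hp u hu).2) S hS
  obtain ⟨S, rfl⟩ := hw
  -- For index `1`, `Y` is replaced by `X` before passing to an exact coupling, so that equality
  -- holds pointwise; otherwise `Y \ X` has positive measure.
  by_cases hc : S.index = 1
  · obtain ⟨S₁, h₁⟩ := S.exists_Y_eq_X hc
    obtain ⟨S₂, hex, -, h₂⟩ := S₁.exists_isExact
    obtain ⟨T, hT, hT1, -⟩ := main S₂ hex
    exact ⟨T, hT, fun _ => hT1 (h₂ h₁), fun h => absurd hc h⟩
  · obtain ⟨S₂, hex, hind, -⟩ := S.exists_isExact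
    obtain ⟨T, hT, -, hT1⟩ := main S₂ hex
    refine ⟨T, hT, fun h => absurd h hc, fun _ => hT1 fun h0 => hc ?_⟩
    have hle : S₂.μ S₂.Y = S₂.μ S₂.X := by
      refine le_antisymm ?_ (measure_mono S₂.subset)
      have := measure_le_inter_add_sdiff S₂.μ S₂.Y S₂.X
      rw [h0, add_zero] at this
      exact this.trans (measure_mono Set.inter_subset_right)
    rw [← hind, SMICoupling.index, hle]
    exact ENNReal.div_self S₂.measure_X_ne_zero S₂.measure_X_ne_top
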